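/- Let $\mathsf{PreOrd}(\mathsf{Set})$ be the category of preordered sets and monotone maps, $\mathsf{ParOrd}(\mathsf{Set})$ its full subcategory of partially ordered sets, $U$ the inclusion and $F$ its left adjoint, which sends a preordered set $(A,\rho)$ to the quotient $A/{\sim_\rho}$, where $a\sim_\rho b$ means $a\mathrel{\rho}b$ and $b\mathrel{\rho}a$, with the induced partial order. Define the following classes of morphisms of $\mathsf{PreOrd}(\mathsf{Set})$: - $\mathcal E$: the morphisms inverted by $F$, that is, the morphisms $f$ such that $F(f)$ is an isomorphism; - $\mathcal M$ (the trivial coverings): the morphisms that are a pullback of a morphism of $\mathsf{ParOrd}(\mathsf{Set})$; - $\mathcal E'$: the morphisms all of whose pullbacks (along arbitrary morphisms) are in $\mathcal E$; - $\mathcal M^*$ (the coverings): the morphisms $f\colon A\to B$ for which there is an effective descent morphism $p\colon E\to B$ (a morphism whose pullback functor $p^*\colon \mathsf{PreOrd}(\mathsf{Set})/B\to \mathsf{PreOrd}(\mathsf{Set})/E$ is monadic) such that the projection $E\times_B A\to E$ is in $\mathcal M$; - $\overline{\mathcal E}$: the monotone maps $f\colon (A,\rho)\to(B,\sigma)$ that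 are surjective and fully faithful, the latter meaning that $x\mathrel{\rho}y$ if and only if $f(x)\mathrel{\sigma}f(y)$, for all $x,y\in A$. A pair of classes of morphisms is called a factorization system if each class is stable under composition with isomorphisms, every morphism of the first class is orthogonal to every morphism of the second (each commutative square from the former to the latter has a unique diagonal), and every morphism is a morphism of the first class followed by a morphism of the second. **Proposition.** The adjunction $F\dashv U$ induces the monotone-light factorization system $(\overline{\mathcal E},\mathcal M^*)$ in $\mathsf{PreOrd}(\mathsf{Set})$. That is: $(\mathcal E,\mathcal M)$ is a factorization system, $\overline{\mathcal E}=\mathcal E'$, and $(\overline{\mathcal E},\mathcal M^*)=(\mathcal E',\mathcal M^*)$ is again a factorization system. -/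

import Mathlib

open CategoryTheory CategoryTheory.Limits

universe u

namespace MonotoneLight

section Generic

variable {C : Type*} [Category* C] {D : Type*} [Category* D]

/-- `e` is orthogonal to `m`: every commutative square from `e` to `m` has exactly one diagonal. -/
def Orthogonal {A B X Y : C} (e : A ⟶ B) (m : X ⟶ Y) : Prop :=
  ∀ (a : A ⟶ X) (b : B ⟶ Y), a ≫ m = e ≫ b → ∃! d : B ⟶ X, e ≫ d = a ∧ d ≫ m = b

/-- An (orthogonal) factorization system: two classes of morphisms, each stable under composition
with isomorphisms on either side, such that every member of the first class is orthogonal to every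
member of the second, and every morphism is a member of the first class followed by a member of
the second. -/
structure IsFactorizationSystem (W₁ W₂ : MorphismProperty C) : Prop where
  respectsIso_left : W₁.RespectsIso
  respectsIso_right : W₂.RespectsIso
  orthogonal : ∀ ⦃A B X Y : C⦄ (e : A ⟶ B) (m : X ⟶ Y), W₁ e → W₂ m → Orthogonal e m
  factorization : ∀ ⦃X Y : C⦄ (f : X ⟶ Y),
    ∃ (Z : C) (e : X ⟶ Z) (m : Z ⟶ Y), W₁ e ∧ W₂ m ∧ e ≫ m = f

/-- The class `𝓔` of morphisms inverted by a functor `F`. -/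
def inverted (F : C ⥤ D) : MorphismProperty C := fun _ _ f => IsIso (F.map f)

/-- The class `𝓔'` of morphisms stably inverted by `F`: all their pullbacks, along arbitrary
morphisms, are inverted by `F`. -/
def stablyInverted (F : C ⥤ D) : MorphismProperty C := fun X Y f =>
  ∀ ⦃X' Y' : C⦄ (g : Y' ⟶ Y) (g' : X' ⟶ X) (f' : X' ⟶ Y'), IsPullback g' f' f g → inverted F f'

/-- The class `𝓜` of trivial coverings: the closure under pullbacks of the class of
morphisms of the subcategory, which is given by its inclusion functor `U`. -/
def trivialCoverings (U : D ⥤ C) : MorphismProperty C := fun X Y f =>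
  ∃ (P Q : D) (g : P ⟶ Q) (a : X ⟶ U.obj P) (b : Y ⟶ U.obj Q), IsPullback a f (U.map g) b

/-- `p : E ⟶ B` is an effective descent morphism: the pullback functor `p^* : C/B ⥤ C/E` is
monadic, i.e. the comparison functor from `C/B` to the Eilenberg–Moore category of the
monad of the adjunction `Σ_p ⊣ p^*` is an equivalence. -/
def IsEffectiveDescent [HasPullbacks C] {E B : C} (p : E ⟶ B) : Prop :=
  (Monad.comparison (Over.mapPullbackAdj p)).IsEquivalence

/-- The class `𝓜^*` of coverings: morphisms `f : A ⟶ B` whose pullback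
`E ×_B A ⟶ E` along some effective descent morphism `p : E ⟶ B` is a trivial covering. -/
def coverings [HasPullbacks C] (U : D ⥤ C) : MorphismProperty C := fun _ B f =>
  ∃ (E : C) (p : E ⟶ B), IsEffectiveDescent p ∧ trivialCoverings U (pullback.fst p f)

/-- The reflection `F ⊣ U` of `C` onto a full subcategory induces the monotone-light factorization
system `(W₁, W₂)`: the classes `𝓔` and `𝓜` of the reflection form a factorization system,
`W₁` is the stabilization `𝓔'` of `𝓔`, `W₂` is the localization `𝓜^*` of `𝓜`, and `(W₁, W₂)` is
again a factorization system. -/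
structure InducesMonotoneLight [HasPullbacks C] {F : C ⥤ D} {U : D ⥤ C} (_adj : F ⊣ U)
    (W₁ W₂ : MorphismProperty C) : Prop where
  fullyFaithful : Nonempty U.FullyFaithful
  isFactorizationSystem_reflective : IsFactorizationSystem (inverted F) (trivialCoverings U)
  eq_stablyInverted : W₁ = stablyInverted F
  eq_coverings : W₂ = coverings U
  isFactorizationSystem : IsFactorizationSystem W₁ W₂

end Generic

/-- The class of monotone maps that are surjective and fully faithful. -/
def surjectiveFullyFaithful : MorphismProperty Preord.{u} := fun A _ f =>
  Function.Surjective f ∧ ∀ x y : A, f x ≤ f y ↔ x ≤ y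

/-- The category of preordered sets has pullbacks: they are computed as in sets, with the
componentwise preorder. -/
instance hasPullbacks_preord : HasPullbacks Preord.{u} := by
  have key : ∀ {X Y Z : Preord.{u}} {f : X ⟶ Z} {g : Y ⟶ Z}, HasLimit (cospan f g) := by
    intro X Y Z f g
    let P : Preord.{u} := .of { q : X × Y // f q.1 = g q.2 }
    let a : P ⟶ X := Preord.ofHom ⟨fun q => q.1.1, fun _ _ h => h.1⟩
    let b : P ⟶ Y := Preord.ofHom ⟨fun q => q.1.2, fun _ _ h => h.2⟩
    have w : a ≫ f = b ≫ g := Preord.ext fun q => q.2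
    exact ⟨⟨⟨PullbackCone.mk a b w, PullbackCone.IsLimit.mk w
      (fun s => Preord.ofHom
        ⟨fun t => ⟨(s.fst t, s.snd t), ConcreteCategory.congr_hom s.condition t⟩,
          fun _ _ h => ⟨s.fst.hom.monotone h, s.snd.hom.monotone h⟩⟩)
      (fun s => rfl) (fun s => rfl)
      (fun s m h₁ h₂ => Preord.ext fun t => Subtype.ext (Prod.ext
        (ConcreteCategory.congr_hom h₁ t) (ConcreteCategory.congr_hom h₂ t)))⟩⟩⟩
  exact hasPullbacks_of_hasLimit_cospan _

end MonotoneLight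

/-! Call points `x ≤ y ≤ x` equivalent. A map is inverted by the reflection exactly when it is fully
faithful and surjective up to equivalence (`inverted_iff`). Full faithfulness survives pullback, but
pulling back along a point forces honest surjectivity, which identifies the stably inverted maps.

The coverings turn out to be the maps whose fibres are antisymmetric (`coverings_iff`). Effective
descent maps are surjective, so a fibre of a covering is seen in its pullback, where the trivial
covering separates equivalent points. Conversely, each `B` is the target of an effective descent map
from a poset, the staircase; a map with antisymmetric fibres, pulled back along it, becomes a map of
posets. Descent for the staircase comes from Beck's monadicity theorem, applied to any map along
which three-term chains lift (`LiftsChains.isEffectiveDescent`).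

With both classes explicit, a map factors by identifying equivalent points within each fibre, and
diagonals come from a set-theoretic section of the surjection. -/

namespace MonotoneLight

/-! ### Orthogonality and stability under isomorphisms for a general adjunction -/

section Generic

variable {C : Type*} [Category* C] {D : Type*} [Category* D]

theorem Orthogonal.of_isPullback {A B X Y X' Y' : C} {e : A ⟶ B} {m : X ⟶ Y} {m' : X' ⟶ Y'}
    {s : X ⟶ X'} {t : Y ⟶ Y'} (h : IsPullback s m m' t) (hm : Orthogonal e m') :
    Orthogonal e m := by
  intro a b w
  obtain ⟨d, ⟨hd₁, hd₂⟩, hd⟩ := hm (a ≫ s) (b ≫ t) (by simp [h.w, reassoc_of% w])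
  refine ⟨h.lift d b hd₂, ⟨h.hom_ext (by simpa using hd₁) (by simpa using w.symm), by simp⟩, ?_⟩
  rintro k ⟨hk₁, hk₂⟩
  refine h.hom_ext ?_ (by simpa using hk₂)
  rw [h.lift_fst]
  exact hd _ ⟨by rw [reassoc_of% hk₁], by rw [Category.assoc, h.w, reassoc_of% hk₂]⟩

/-- Under the adjunction, precomposition with `e` becomes precomposition with the isomorphism `F.map
e`, so maps into objects `U.obj Z` extend uniquely along `e`. The lower triangle then follows from
this uniqueness. -/
theorem orthogonal_map_of_isIso {F : C ⥤ D} {U : D ⥤ C} (adj : F ⊣ U) {A B : C} {e : A ⟶ B}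
    (he : IsIso (F.map e)) {P Q : D} (g : P ⟶ Q) : Orthogonal e (U.map g) := by
  intro a b w
  have key : ∀ {Z : D} (k : B ⟶ U.obj Z),
      (adj.homEquiv B Z).symm k = inv (F.map e) ≫ (adj.homEquiv A Z).symm (e ≫ k) := by
    intro Z k
    rw [adj.homEquiv_naturality_left_symm, IsIso.inv_hom_id_assoc]
  have inj : ∀ {Z : D} (k l : B ⟶ U.obj Z), e ≫ k = e ≫ l → k = l := by
    intro Z k l h
    apply (adj.homEquiv B Z).symm.injective
    rw [key, key, h]
  have hd : e ≫ adj.homEquiv B P (inv (F.map e) ≫ (adj.homEquiv A P).symm a) = a := by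
    rw [← adj.homEquiv_naturality_left, IsIso.hom_inv_id_assoc, Equiv.apply_symm_apply]
  refine ⟨_, ⟨hd, inj _ _ (by rw [reassoc_of% hd, w])⟩, ?_⟩
  rintro k ⟨hk, -⟩
  exact inj _ _ (hk.trans hd.symm)

theorem inverted_respectsIso (F : C ⥤ D) : (inverted F).RespectsIso := by
  refine .mk _ (fun e f (_ : IsIso _) => ?_) (fun e f (_ : IsIso _) => ?_) <;>
  · change IsIso _
    rw [F.map_comp]
    infer_instance

theorem trivialCoverings_respectsIso (U : D ⥤ C) : (trivialCoverings U).RespectsIso := by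
  refine .mk _ ?_ ?_
  · rintro X Y Z e f ⟨P, Q, g, a, b, h⟩
    refine ⟨P, Q, g, e.hom ≫ a, b, ?_⟩
    have := (IsPullback.of_horiz_isIso (fst := e.hom) (snd := e.hom ≫ f) (f := f) (g := 𝟙 _)
      ⟨by simp⟩).paste_horiz h
    simpa using this
  · rintro X Y Z e f ⟨P, Q, g, a, b, h⟩
    refine ⟨P, Q, g, a, e.inv ≫ b, ?_⟩
    have := (IsPullback.of_horiz_isIso (fst := 𝟙 _) (snd := f ≫ e.hom) (f := f) (g := e.inv)
      ⟨by simp⟩).paste_horiz h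
    simpa using this

end Generic

/-! ### Pullbacks and isomorphisms of preordered sets, pointwise -/

/-- The pullback of preordered sets: pairs with the componentwise preorder. -/
abbrev pairs {X Y Z : Preord.{u}} (f : X ⟶ Z) (g : Y ⟶ Z) : Preord.{u} :=
  .of { q : X × Y // f q.1 = g q.2 }

/-- The first projection of the pullback of preordered sets. -/
abbrev pairsFst {X Y Z : Preord.{u}} (f : X ⟶ Z) (g : Y ⟶ Z) : pairs f g ⟶ X :=
  Preord.ofHom ⟨fun q => q.1.1, fun _ _ h => h.1⟩

/-- The second projection of the pullback of preordered sets. -/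
abbrev pairsSnd {X Y Z : Preord.{u}} (f : X ⟶ Z) (g : Y ⟶ Z) : pairs f g ⟶ Y :=
  Preord.ofHom ⟨fun q => q.1.2, fun _ _ h => h.2⟩

theorem isPullback_pairs {X Y Z : Preord.{u}} (f : X ⟶ Z) (g : Y ⟶ Z) :
    IsPullback (pairsFst f g) (pairsSnd f g) f g where
  w := Preord.ext fun q => q.2
  isLimit' := ⟨PullbackCone.IsLimit.mk _
      (fun s => Preord.ofHom
        ⟨fun t => ⟨(s.fst t, s.snd t), ConcreteCategory.congr_hom s.condition t⟩,
          fun _ _ h => ⟨s.fst.hom.monotone h, s.snd.hom.monotone h⟩⟩)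
      (fun _ => rfl) (fun _ => rfl)
      (fun _ _ h₁ h₂ => Preord.ext fun t => Subtype.ext (Prod.ext
        (ConcreteCategory.congr_hom h₁ t) (ConcreteCategory.congr_hom h₂ t)))⟩

theorem isIso_of_surjective_of_le_iff {X Y : Preord.{u}} (f : X ⟶ Y)
    (hi : Function.Injective f) (hs : Function.Surjective f)
    (hf : ∀ x y : X, f x ≤ f y ↔ x ≤ y) : IsIso f := by
  let e : X ≃o Y := { Equiv.ofBijective f ⟨hi, hs⟩ with map_rel_iff' := fun {x y} => hf x y }
  refine ⟨⟨Preord.ofHom e.symm, ?_, ?_⟩⟩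
  · exact Preord.ext fun x => e.symm_apply_apply x
  · exact Preord.ext fun y => e.apply_symm_apply y

theorem le_iff_of_isIso {X Y : Preord.{u}} (f : X ⟶ Y) [IsIso f] (x y : X) :
    f x ≤ f y ↔ x ≤ y := by
  refine ⟨fun h => ?_, fun h => f.hom.monotone h⟩
  simpa [← Preord.comp_apply] using (inv f).hom.monotone h

theorem bijective_of_isIso {X Y : Preord.{u}} (f : X ⟶ Y) [IsIso f] : Function.Bijective f := by
  refine ⟨fun x y h => ?_, fun y => ⟨inv f y, ?_⟩⟩
  · simpa [← Preord.comp_apply] using congrArg (inv f) h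
  · rw [← Preord.comp_apply, IsIso.inv_hom_id, Preord.id_apply]

section IsPullback

variable {P X Y Z : Preord.{u}} {fst : P ⟶ X} {snd : P ⟶ Y} {f : X ⟶ Z} {g : Y ⟶ Z}

theorem exists_of_isPullback (h : IsPullback fst snd f g) {x : X} {y : Y} (w : f x = g y) :
    ∃ z : P, fst z = x ∧ snd z = y := by
  let q : pairs f g := ⟨(x, y), w⟩
  let l := h.lift (pairsFst f g) (pairsSnd f g) (isPullback_pairs f g).w
  exact ⟨l q, ConcreteCategory.congr_hom (h.lift_fst _ _ _) q,
    ConcreteCategory.congr_hom (h.lift_snd _ _ _) q⟩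

theorem le_iff_of_isPullback (h : IsPullback fst snd f g) {z z' : P} :
    z ≤ z' ↔ fst z ≤ fst z' ∧ snd z ≤ snd z' := by
  rw [← le_iff_of_isIso (h.isoIsPullback _ _ (isPullback_pairs f g)).hom z z']
  have h₁ := fun z : P => ConcreteCategory.congr_hom
    (h.isoIsPullback_hom_fst _ _ (isPullback_pairs f g)) z
  have h₂ := fun z : P => ConcreteCategory.congr_hom
    (h.isoIsPullback_hom_snd _ _ (isPullback_pairs f g)) z
  rw [← h₁, ← h₁ z', ← h₂, ← h₂ z']
  exact Iff.rfl

theorem eq_of_isPullback (h : IsPullback fst snd f g) {z z' : P}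
    (h₁ : fst z = fst z') (h₂ : snd z = snd z') : z = z' := by
  apply (bijective_of_isIso (h.isoIsPullback _ _ (isPullback_pairs f g)).hom).1
  refine Subtype.ext (Prod.ext ?_ ?_)
  · exact (ConcreteCategory.congr_hom (h.isoIsPullback_hom_fst _ _ (isPullback_pairs f g)) z).trans
      (h₁.trans (ConcreteCategory.congr_hom
        (h.isoIsPullback_hom_fst _ _ (isPullback_pairs f g)) z').symm)
  · exact (ConcreteCategory.congr_hom (h.isoIsPullback_hom_snd _ _ (isPullback_pairs f g)) z).trans
      (h₂.trans (ConcreteCategory.congr_hom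
        (h.isoIsPullback_hom_snd _ _ (isPullback_pairs f g)) z').symm)

theorem apply_eq_of_isPullback (h : IsPullback fst snd f g) (z : P) : f (fst z) = g (snd z) :=
  ConcreteCategory.congr_hom h.w z

end IsPullback

/-! ### The reflective factorization and the stably inverted maps -/

/-- The reflection of a monotone map in partially ordered sets is invertible exactly when the map
is fully faithful and surjective up to equivalence. -/
theorem inverted_iff {A B : Preord.{u}} (f : A ⟶ B) :
    inverted preordToPartOrd f ↔
      (∀ x y : A, f x ≤ f y ↔ x ≤ y) ∧ ∀ b : B, ∃ a : A, f a ≤ b ∧ b ≤ f a := by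
  have mk : ∀ a : A, preordToPartOrd.map f (toAntisymmetrization (· ≤ ·) a) =
    toAntisymmetrization (· ≤ ·) (f a) := fun a => rfl
  constructor
  · intro h
    have h' : IsIso (preordToPartOrd.map f) := h
    have hf : IsIso ((forget₂ PartOrd Preord).map (preordToPartOrd.map f)) := inferInstance
    refine ⟨fun x y => ?_, fun b => ?_⟩
    · exact le_iff_of_isIso ((forget₂ PartOrd Preord).map (preordToPartOrd.map f))
        (toAntisymmetrization (· ≤ ·) x) (toAntisymmetrization (· ≤ ·) y)
    · obtain ⟨a, ha⟩ := (bijective_of_isIso ((forget₂ PartOrd Preord).map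
        (preordToPartOrd.map f))).2 (toAntisymmetrization (· ≤ ·) b)
      induction a using Quotient.inductionOn' with | _ a
      have := Quotient.exact' ha
      exact ⟨a, this.1, this.2⟩
  · rintro ⟨h₁, h₂⟩
    let φ : preordToPartOrd.obj A ↪o preordToPartOrd.obj B :=
      OrderEmbedding.ofMapLEIff (preordToPartOrd.map f)
        (fun a b => Quotient.inductionOn₂' a b h₁)
    have hφ : Function.Surjective φ := fun b => by
      induction b using Quotient.inductionOn' with | _ b
      obtain ⟨a, ha⟩ := h₂ b
      exact ⟨toAntisymmetrization (· ≤ ·) a, Quotient.sound' ha⟩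
    have : preordToPartOrd.map f = (PartOrd.Iso.mk (RelIso.ofSurjective φ hφ)).hom := rfl
    change IsIso (preordToPartOrd.map f)
    rw [this]
    infer_instance

/-- The middle object is the pullback of the reflected map along the unit of `Y`. A point of it is a
class `[a]` with some `b` equivalent to `f a`, so it is equivalent to the image of `a`. -/
theorem exists_inverted_trivialCovering_fac {X Y : Preord.{u}} (f : X ⟶ Y) :
    ∃ (Z : Preord.{u}) (e : X ⟶ Z) (m : Z ⟶ Y), inverted preordToPartOrd e ∧
      trivialCoverings (forget₂ PartOrd Preord) m ∧ e ≫ m = f := by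
  let t := (forget₂ PartOrd.{u} Preord.{u}).map (preordToPartOrd.map f)
  let η : Y ⟶ (forget₂ PartOrd Preord).obj (preordToPartOrd.obj Y) :=
    Preord.ofHom ⟨toAntisymmetrization (· ≤ ·), toAntisymmetrization_mono⟩
  let e : X ⟶ pairs t η := Preord.ofHom
    ⟨fun x => ⟨(toAntisymmetrization (· ≤ ·) x, f x), rfl⟩, fun _ _ h => ⟨h, f.hom.monotone h⟩⟩
  refine ⟨_, e, pairsSnd t η, (inverted_iff e).2
    ⟨fun x y => ⟨fun h => h.1, fun h => e.hom.monotone h⟩, ?_⟩,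
    ⟨_, _, preordToPartOrd.map f, _, _, isPullback_pairs t η⟩, rfl⟩
  rintro ⟨⟨a, b⟩, hab⟩
  induction a using Quotient.inductionOn' with | _ a
  have hab' : AntisymmRel (· ≤ ·) (f a) b := Quotient.exact' hab
  exact ⟨a, ⟨le_rfl, hab'.1⟩, ⟨le_rfl, hab'.2⟩⟩

theorem isFactorizationSystem_inverted_trivialCoverings :
    IsFactorizationSystem (inverted preordToPartOrd.{u})
      (trivialCoverings (forget₂ PartOrd.{u} Preord.{u})) where
  respectsIso_left := inverted_respectsIso _
  respectsIso_right := trivialCoverings_respectsIso _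
  orthogonal := by
    rintro A B X Y e m he ⟨P, Q, g, a, b, h⟩
    exact .of_isPullback h (orthogonal_map_of_isIso preordToPartOrdForgetAdjunction he g)
  factorization := fun _ _ f => exists_inverted_trivialCovering_fac f

theorem surjectiveFullyFaithful_eq_stablyInverted :
    surjectiveFullyFaithful.{u} = stablyInverted preordToPartOrd := by
  ext A B f
  constructor
  · rintro ⟨hs, hf⟩ A' B' g g' f' h
    rw [inverted_iff]
    refine ⟨fun x y => ⟨fun hxy => ?_, fun hxy => f'.hom.monotone hxy⟩, fun b => ?_⟩
    · refine (le_iff_of_isPullback h).2 ⟨?_, hxy⟩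
      rw [← hf, apply_eq_of_isPullback h, apply_eq_of_isPullback h]
      exact g.hom.monotone hxy
    · obtain ⟨a, ha⟩ := hs (g b)
      obtain ⟨z, -, hz⟩ := exists_of_isPullback h ha
      exact ⟨z, hz.le, hz.ge⟩
  · intro h
    refine ⟨fun b => ?_, ((inverted_iff f).1 (h _ _ _ (IsPullback.id_horiz f))).1⟩
    -- The pullback along the point `b` is the fibre over `b`; surjectivity up to equivalence onto a
    -- singleton says that it is nonempty.
    let g : Preord.of PUnit.{u + 1} ⟶ B := Preord.ofHom ⟨fun _ => b, fun _ _ _ => le_rfl⟩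
    obtain ⟨a, -⟩ := ((inverted_iff _).1 (h g _ _ (isPullback_pairs f g))).2 PUnit.unit
    exact ⟨a.1.1, a.2⟩

/-! ### Pullback functors between slices; effective descent maps are surjective -/

section Over

variable {E B : Preord.{u}} (p : E ⟶ B)

theorem isIso_over_of_surjective_of_le_iff {X Y : Over B} (f : X ⟶ Y)
    (hi : Function.Injective f.left) (hs : Function.Surjective f.left)
    (hf : ∀ x y : X.left, f.left x ≤ f.left y ↔ x ≤ y) : IsIso f := by
  have : IsIso ((Over.forget B).map f) := isIso_of_surjective_of_le_iff f.left hi hs hf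
  exact isIso_of_reflects_iso f (Over.forget B)

/-- The total space of a pullback `p^* X`, as a pullback square. -/
theorem isPullback_overPullback (X : Over B) :
    IsPullback (P := ((Over.pullback p).obj X).left) (pullback.fst X.hom p)
      ((Over.pullback p).obj X).hom X.hom p :=
  IsPullback.of_hasPullback X.hom p

theorem fst_overPullback_map {X Y : Over B} (f : X ⟶ Y) (z : ((Over.pullback p).obj X).left) :
    pullback.fst Y.hom p (((Over.pullback p).map f).left z) =
      f.left (pullback.fst X.hom p z) := by
  have : ((Over.pullback p).map f).left ≫ pullback.fst Y.hom p =
    pullback.fst X.hom p ≫ f.left :=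
    pullback.lift_fst _ _ _
  exact ConcreteCategory.congr_hom this z

theorem over_comp_apply {X Y Z : Over B} (f : X ⟶ Y) (g : Y ⟶ Z) (x : X.left) :
    (f ≫ g).left x = g.left (f.left x) :=
  rfl

theorem over_hom_apply {X Y : Over B} (f : X ⟶ Y) (x : X.left) :
    Y.hom (f.left x) = X.hom x :=
  ConcreteCategory.congr_hom (Over.w f) x

variable {p}

/-- Monadic functors reflect isomorphisms, and `p^*` inverts the inclusion of the range of `p`, with
its induced order, into `B`. -/
theorem IsEffectiveDescent.surjective (hp : IsEffectiveDescent p) : Function.Surjective p := by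
  have : (Monad.comparison (Over.mapPullbackAdj p)).IsEquivalence := hp
  have hr : (Over.pullback p).ReflectsIsomorphisms :=
    reflectsIsomorphisms_of_iso (Monad.comparisonForget (Over.mapPullbackAdj p))
  let i : Preord.of (Set.range p) ⟶ B := Preord.ofHom ⟨Subtype.val, fun _ _ h => h⟩
  let k : Over.mk i ⟶ Over.mk (𝟙 B) := Over.homMk i
  have hX := isPullback_overPullback p (Over.mk i)
  have hY := isPullback_overPullback p (Over.mk (𝟙 B))
  have hk : IsIso ((Over.pullback p).map k) := by
    refine isIso_over_of_surjective_of_le_iff _ (fun z z' h => ?_) (fun z => ?_) (fun z z' => ?_)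
    · refine eq_of_isPullback hX (Subtype.ext ?_) ?_
      · exact (fst_overPullback_map p k z).symm.trans
          ((congrArg _ h).trans (fst_overPullback_map p k z'))
      · rw [← over_hom_apply ((Over.pullback p).map k), h, over_hom_apply]
    · obtain ⟨x, hx₁, hx₂⟩ := exists_of_isPullback hX (x := ⟨_, Set.mem_range_self
        (((Over.pullback p).obj (Over.mk (𝟙 B))).hom z)⟩) rfl
      refine ⟨x, eq_of_isPullback hY ?_ ?_⟩
      · rw [fst_overPullback_map, hx₁]
        exact (apply_eq_of_isPullback hY z).symm
      · rw [over_hom_apply, hx₂]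
    · rw [le_iff_of_isPullback hX, le_iff_of_isPullback hY, over_hom_apply, over_hom_apply,
        fst_overPullback_map, fst_overPullback_map]
      exact Iff.rfl
  have : IsIso k := isIso_of_reflects_iso k (Over.pullback p)
  have hi : IsIso i := inferInstanceAs (IsIso ((Over.forget B).map k))
  intro b
  obtain ⟨⟨_, e, he⟩, rfl⟩ := (bijective_of_isIso i).2 b
  exact ⟨e, he⟩

end Over

/-! ### Coequalizers of preordered sets, and over a base -/

section Coequalizer

variable {X Y : Preord.{u}} (f g : X ⟶ Y)

/-- The underlying set of the coequalizer of two monotone maps. -/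
def Coeq : Type u := Quot fun y y' : Y => ∃ x, f x = y ∧ g x = y'

/-- The class of an element in the coequalizer. -/
def Coeq.mk (y : Y) : Coeq f g := Quot.mk _ y

/-- The relation which the order of `Y` induces on the coequalizer; it need not be transitive. -/
def Coeq.Rel (a a' : Coeq f g) : Prop :=
  ∃ y y' : Y, mk f g y = a ∧ mk f g y' = a' ∧ y ≤ y'

instance : Preorder (Coeq f g) where
  le := Relation.ReflTransGen (Coeq.Rel f g)
  le_refl _ := .refl
  le_trans _ _ _ := .trans

theorem Coeq.mk_mono : Monotone (Coeq.mk f g) := fun y y' h => .single ⟨y, y', rfl, rfl, h⟩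

/-- The coequalizer projection. -/
def coeqπ : Y ⟶ Preord.of (Coeq f g) := Preord.ofHom ⟨Coeq.mk f g, Coeq.mk_mono f g⟩

theorem coeqπ_condition : f ≫ coeqπ f g = g ≫ coeqπ f g :=
  Preord.ext fun x => Quot.sound ⟨x, rfl, rfl⟩

variable {f g}

theorem Coeq.mk_surjective : Function.Surjective (Coeq.mk f g) := Quot.mk_surjective

/-- The monotone map out of the coequalizer induced by a map coequalizing the pair. -/
def coeqDesc {T : Preord.{u}} (h : Y ⟶ T) (w : f ≫ h = g ≫ h) : Preord.of (Coeq f g) ⟶ T :=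
  Preord.ofHom
    { toFun := Quot.lift h (by
        rintro _ _ ⟨x, rfl, rfl⟩
        exact ConcreteCategory.congr_hom w x)
      monotone' := by
        intro a a' (haa' : Relation.ReflTransGen (Coeq.Rel f g) a a')
        induction haa' with
        | refl => exact le_rfl
        | tail _ hr ih =>
          obtain ⟨y, y', rfl, rfl, hy⟩ := hr
          exact ih.trans (h.hom.monotone hy) }

theorem coeq_hom_ext {T : Preord.{u}} {k l : Preord.of (Coeq f g) ⟶ T}
    (h : coeqπ f g ≫ k = coeqπ f g ≫ l) : k = l := by
  refine Preord.ext fun a => ?_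
  obtain ⟨y, rfl⟩ := Coeq.mk_surjective a
  exact ConcreteCategory.congr_hom h y

end Coequalizer

section OverCoequalizer

variable {B : Preord.{u}} {X Y : Over B} (f g : X ⟶ Y)

/-- The coequalizer of a pair of maps over `B`. -/
def overCoeq : Over B :=
  Over.mk (coeqDesc (f := f.left) (g := g.left) Y.hom ((Over.w f).trans (Over.w g).symm))

/-- The coequalizer projection over `B`. -/
def overCoeqπ : Y ⟶ overCoeq f g := Over.homMk (coeqπ f.left g.left) rfl

theorem overCoeqπ_apply (y : Y.left) :
    (overCoeqπ f g).left y = Coeq.mk f.left g.left y :=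
  rfl

theorem overCoeqπ_condition : f ≫ overCoeqπ f g = g ≫ overCoeqπ f g :=
  Over.OverMorphism.ext (coeqπ_condition f.left g.left :)

/-- The cofork of the coequalizer over `B` is a colimit. -/
def isColimitOverCoeq : IsColimit (Cofork.ofπ (overCoeqπ f g) (overCoeqπ_condition f g)) :=
  Cofork.IsColimit.mk _
    (fun s => Over.homMk (coeqDesc s.π.left (by
      rw [← Over.comp_left, s.condition, Over.comp_left])) (coeq_hom_ext (Over.w s.π)))
    (fun _ => Over.OverMorphism.ext rfl)
    (fun s m h => Over.OverMorphism.ext (coeq_hom_ext 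
      (congrArg (fun k => k.left) h :)))

end OverCoequalizer

/-! ### Maps lifting three-term chains are effective descent morphisms -/

section Descent

variable {E B : Preord.{u}} {p : E ⟶ B}

/-- Every chain `b₀ ≤ b₁ ≤ b₂` in the codomain lifts along the monotone map `p`. -/
def LiftsChains (p : E ⟶ B) : Prop :=
  ∀ b₀ b₁ b₂ : B, b₀ ≤ b₁ → b₁ ≤ b₂ → ∃ e₀ e₁ e₂ : E, e₀ ≤ e₁ ∧ e₁ ≤ e₂ ∧
    p e₀ = b₀ ∧ p e₁ = b₁ ∧ p e₂ = b₂

theorem LiftsChains.surjective (hp : LiftsChains p) : Function.Surjective p := fun b => by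
  obtain ⟨e, -, -, -, -, he, -, -⟩ := hp b b b le_rfl le_rfl
  exact ⟨e, he⟩

theorem LiftsChains.reflectsIsomorphisms_overPullback (hp : LiftsChains p) :
    (Over.pullback p).ReflectsIsomorphisms := by
  refine ⟨fun {X Y} k _ => ?_⟩
  have hk : IsIso ((Over.pullback p).map k).left :=
    inferInstanceAs (IsIso ((Over.forget E).map ((Over.pullback p).map k)))
  have hX := isPullback_overPullback p X
  have hY := isPullback_overPullback p Y
  have hs := LiftsChains.surjective hp
  refine isIso_over_of_surjective_of_le_iff k (fun x x' h => ?_) (fun y => ?_)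
    (fun x x' => ⟨fun h => ?_, fun h => k.left.hom.monotone h⟩)
  · obtain ⟨e, he⟩ := hs (X.hom x)
    have he' : p e = X.hom x' := by rw [he, ← over_hom_apply k, h, over_hom_apply]
    obtain ⟨z, hz₁, hz₂⟩ := exists_of_isPullback hX he.symm
    obtain ⟨z', hz₁', hz₂'⟩ := exists_of_isPullback hX he'.symm
    rw [← hz₁, ← hz₁']
    congr 1
    apply (bijective_of_isIso ((Over.pullback p).map k).left).1
    refine eq_of_isPullback hY ?_ ?_
    · rw [fst_overPullback_map, fst_overPullback_map, hz₁, hz₁', h]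
    · rw [over_hom_apply, over_hom_apply, hz₂, hz₂']
  · obtain ⟨e, he⟩ := hs (Y.hom y)
    obtain ⟨w, hw, -⟩ := exists_of_isPullback hY he.symm
    obtain ⟨z, rfl⟩ := (bijective_of_isIso ((Over.pullback p).map k).left).2 w
    exact ⟨_, (fst_overPullback_map p k z).symm.trans hw⟩
  · have hb : X.hom x ≤ X.hom x' := by
      rw [← over_hom_apply k, ← over_hom_apply k x']
      exact Y.hom.hom.monotone h
    -- Only two-term chains matter for reflecting isomorphisms, so the last step of the chain is
    -- taken trivial.
    obtain ⟨e, e', -, hee', -, he, he', -⟩ := hp _ _ _ hb le_rfl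
    obtain ⟨z, hz₁, hz₂⟩ := exists_of_isPullback hX he.symm
    obtain ⟨z', hz₁', hz₂'⟩ := exists_of_isPullback hX he'.symm
    rw [← hz₁, ← hz₁']
    apply (pullback.fst X.hom p).hom.monotone
    rw [← le_iff_of_isIso ((Over.pullback p).map k).left, le_iff_of_isPullback hY,
      fst_overPullback_map, fst_overPullback_map, over_hom_apply, over_hom_apply, hz₁, hz₁', hz₂,
      hz₂']
    exact ⟨h, hee'⟩

variable {X Y : Over B} {f g : X ⟶ Y} {W : Over E} {q : (Over.pullback p).obj Y ⟶ W}

/-- Points of `p^* Y` with the same base point and the same class in the coequalizer of `f, g` are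
identified by every map coequalizing `p^* f, p^* g`. -/
theorem apply_eq_of_coeq_mk_eq
    (hq : (Over.pullback p).map f ≫ q = (Over.pullback p).map g ≫ q)
    {z z' : ((Over.pullback p).obj Y).left}
    (h : Coeq.mk f.left g.left (pullback.fst Y.hom p z) =
      Coeq.mk f.left g.left (pullback.fst Y.hom p z'))
    (he : ((Over.pullback p).obj Y).hom z = ((Over.pullback p).obj Y).hom z') :
    q.left z = q.left z' := by
  have hX := isPullback_overPullback p X
  have hY := isPullback_overPullback p Y
  -- Equality of base points is carried through the induction so that, in the transitive case, the
  -- intermediate point can be lifted over the same point of `E`.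
  have key : ∀ y y' : Y.left, Relation.EqvGen (fun y y' => ∃ x, f.left x = y ∧ g.left x = y') y y' →
      Y.hom y = Y.hom y' ∧ ∀ z z' : ((Over.pullback p).obj Y).left, pullback.fst Y.hom p z = y →
        pullback.fst Y.hom p z' = y' →
        ((Over.pullback p).obj Y).hom z = ((Over.pullback p).obj Y).hom z' →
        q.left z = q.left z' := by
    intro y y' hyy'
    induction hyy' with
    | rel y y' hr =>
      obtain ⟨x, rfl, rfl⟩ := hr
      refine ⟨by rw [over_hom_apply, over_hom_apply], fun z z' h h' he => ?_⟩
      have hx : X.hom x = p (((Over.pullback p).obj Y).hom z) := by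
        rw [← apply_eq_of_isPullback hY, h, over_hom_apply]
      obtain ⟨t, ht₁, ht₂⟩ := exists_of_isPullback hX hx
      have h₁ : ((Over.pullback p).map f).left t = z :=
        eq_of_isPullback hY (by rw [fst_overPullback_map, ht₁, h]) (by rw [over_hom_apply, ht₂])
      have h₂ : ((Over.pullback p).map g).left t = z' :=
        eq_of_isPullback hY (by rw [fst_overPullback_map, ht₁, h'])
          (by rw [over_hom_apply, ht₂, he])
      rw [← h₁, ← h₂]
      exact ConcreteCategory.congr_hom (congrArg (fun k => k.left) hq) t
    | refl y =>
      exact ⟨rfl, fun z z' h h' he => by rw [eq_of_isPullback hY (h.trans h'.symm) he]⟩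
    | symm y y' _ ih => exact ⟨ih.1.symm, fun z z' h h' he => (ih.2 z' z h' h he.symm).symm⟩
    | trans y₁ y₂ y₃ _ _ ih ih' =>
      refine ⟨ih.1.trans ih'.1, fun z z' h h' he => ?_⟩
      have hy : Y.hom y₂ = p (((Over.pullback p).obj Y).hom z) := by
        rw [← apply_eq_of_isPullback hY, h, ih.1]
      obtain ⟨t, ht₁, ht₂⟩ := exists_of_isPullback hY hy
      exact (ih.2 z t h ht₁ ht₂.symm).trans (ih'.2 t z' ht₁ h' (ht₂.trans he))
  exact (key _ _ (Quot.eqvGen_exact h)).2 z z' rfl rfl he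

theorem hom_eq_of_coeq_mk_eq {y y' : Y.left}
    (h : Coeq.mk f.left g.left y = Coeq.mk f.left g.left y') : Y.hom y = Y.hom y' :=
  congrArg (overCoeq f g).hom h

/-- If `p` lifts chains of length two, then for a `p^*`-split pair the relation induced on the
coequalizer is already transitive. -/
theorem coeq_rel_of_le (hp : LiftsChains p)
    (σ : IsSplitCoequalizer ((Over.pullback p).map f) ((Over.pullback p).map g) q)
    {k : W ⟶ (Over.pullback p).obj (overCoeq f g)}
    (hk : q ≫ k = (Over.pullback p).map (overCoeqπ f g))
    {a a' : Coeq f.left g.left} (h : a ≤ a') : Coeq.Rel f.left g.left a a' := by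
  have hY := isPullback_overPullback p Y
  -- The splitting sends `q z` to a possibly different point of `p^* Y`, but one still in the same
  -- class of the coequalizer.
  have hs : ∀ z, Coeq.mk f.left g.left (pullback.fst Y.hom p (σ.rightSection.left (q.left z))) =
      Coeq.mk f.left g.left (pullback.fst Y.hom p z) := by
    intro z
    have h₁ := fst_overPullback_map p (overCoeqπ f g)
    have h₂ : (q ≫ σ.rightSection) ≫ (Over.pullback p).map (overCoeqπ f g) =
        (Over.pullback p).map (overCoeqπ f g) := by
      rw [← hk, Category.assoc, σ.rightSection_π_assoc]
    have h₃ := ConcreteCategory.congr_hom (congrArg (fun k => k.left) h₂) z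
    rw [over_comp_apply, over_comp_apply] at h₃
    rw [← overCoeqπ_apply, ← overCoeqπ_apply, ← h₁, ← h₁, h₃]
  replace h : Relation.ReflTransGen (Coeq.Rel f.left g.left) a a' := h
  induction h with
  | refl =>
    obtain ⟨y, rfl⟩ := Coeq.mk_surjective a
    exact ⟨y, y, rfl, rfl, le_rfl⟩
  | tail _ hr ih =>
    obtain ⟨y₀, y₁, rfl, rfl, h₀₁⟩ := ih
    obtain ⟨y₁', y₂, h₁, rfl, h₁₂⟩ := hr
    have hb : Y.hom y₁' = Y.hom y₁ := hom_eq_of_coeq_mk_eq h₁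
    -- The representatives `y₁` and `y₁'` of the middle class may differ, but share a base point.
    -- Lifting both over the same `e₁` makes `q` identify them, so the two inequalities compose in
    -- `W`; the splitting brings the result back to `Y`.
    obtain ⟨e₀, e₁, e₂, he₀₁, he₁₂, he₀, he₁, he₂⟩ :=
      hp _ _ _ (Y.hom.hom.monotone h₀₁) (hb.ge.trans (Y.hom.hom.monotone h₁₂))
    obtain ⟨z₀, hz₀, hz₀'⟩ := exists_of_isPullback hY he₀.symm
    obtain ⟨z₁, hz₁, hz₁'⟩ := exists_of_isPullback hY he₁.symm
    obtain ⟨w₁, hw₁, hw₁'⟩ := exists_of_isPullback hY (hb.trans he₁.symm)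
    obtain ⟨z₂, hz₂, hz₂'⟩ := exists_of_isPullback hY he₂.symm
    have hz₀₁ : z₀ ≤ z₁ := by
      rw [le_iff_of_isPullback hY, hz₀, hz₁, hz₀', hz₁']
      exact ⟨h₀₁, he₀₁⟩
    have hz₁₂ : w₁ ≤ z₂ := by
      rw [le_iff_of_isPullback hY, hw₁, hz₂, hw₁', hz₂']
      exact ⟨h₁₂, he₁₂⟩
    have hq₁ : q.left w₁ = q.left z₁ :=
      apply_eq_of_coeq_mk_eq σ.condition (by rw [hw₁, hz₁, h₁]) (hw₁'.trans hz₁'.symm)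
    have hq : q.left z₀ ≤ q.left z₂ :=
      (q.left.hom.monotone hz₀₁).trans (hq₁.ge.trans (q.left.hom.monotone hz₁₂))
    refine ⟨_, _, (hs z₀).trans (by rw [hz₀]), (hs z₂).trans (by rw [hz₂]), ?_⟩
    exact (pullback.fst Y.hom p).hom.monotone (σ.rightSection.left.hom.monotone hq)

/-- This is preservation of split-pair coequalizers: `k` compares the split coequalizer with the
pulled-back one. Injectivity is `apply_eq_of_coeq_mk_eq`; order reflection needs `coeq_rel_of_le`,
which replaces a zigzag by one inequality in `Y`. -/
theorem isIso_of_isSplitCoequalizer (hp : LiftsChains p)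
    (σ : IsSplitCoequalizer ((Over.pullback p).map f) ((Over.pullback p).map g) q)
    {k : W ⟶ (Over.pullback p).obj (overCoeq f g)}
    (hk : q ≫ k = (Over.pullback p).map (overCoeqπ f g)) : IsIso k := by
  have hY := isPullback_overPullback p Y
  have hQ := isPullback_overPullback p (overCoeq f g)
  have hq : Function.Surjective q.left := fun w =>
    ⟨σ.rightSection.left w,
      ConcreteCategory.congr_hom (congrArg (fun k => k.left) σ.rightSection_π) w⟩
  have hfst : ∀ z, pullback.fst (overCoeq f g).hom p (k.left (q.left z)) =
      Coeq.mk f.left g.left (pullback.fst Y.hom p z) := by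
    intro z
    rw [← over_comp_apply, hk, fst_overPullback_map, overCoeqπ_apply]
  have hsnd : ∀ z, ((Over.pullback p).obj (overCoeq f g)).hom (k.left (q.left z)) =
      ((Over.pullback p).obj Y).hom z := by
    intro z
    rw [over_hom_apply, over_hom_apply]
  refine isIso_over_of_surjective_of_le_iff k ?_ ?_ ?_
  · intro w w' h
    obtain ⟨z, rfl⟩ := hq w
    obtain ⟨z', rfl⟩ := hq w'
    refine apply_eq_of_coeq_mk_eq σ.condition ?_ ?_
    · rw [← hfst, ← hfst, h]
    · rw [← hsnd, ← hsnd, h]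
  · intro v
    obtain ⟨y, hy⟩ := Coeq.mk_surjective (pullback.fst (overCoeq f g).hom p v)
    have he : Y.hom y = p (((Over.pullback p).obj (overCoeq f g)).hom v) := by
      rw [← apply_eq_of_isPullback hQ, ← hy]
      rfl
    obtain ⟨z, hz₁, hz₂⟩ := exists_of_isPullback hY he
    refine ⟨q.left z, eq_of_isPullback hQ ?_ ?_⟩
    · rw [hfst, hz₁, hy]
    · rw [hsnd, hz₂]
  · intro w w'
    refine ⟨fun h => ?_, fun h => k.left.hom.monotone h⟩
    obtain ⟨z, rfl⟩ := hq w
    obtain ⟨z', rfl⟩ := hq w'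
    rw [le_iff_of_isPullback hQ, hfst, hfst, hsnd, hsnd] at h
    obtain ⟨y, y', hy, hy', hyy'⟩ := coeq_rel_of_le hp σ hk h.1
    obtain ⟨t, ht₁, ht₂⟩ := exists_of_isPullback hY
      ((hom_eq_of_coeq_mk_eq hy).trans (apply_eq_of_isPullback hY z))
    obtain ⟨t', ht₁', ht₂'⟩ := exists_of_isPullback hY
      ((hom_eq_of_coeq_mk_eq hy').trans (apply_eq_of_isPullback hY z'))
    have h₁ : q.left t = q.left z :=
      apply_eq_of_coeq_mk_eq σ.condition (by rw [ht₁, hy]) ht₂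
    have h₂ : q.left t' = q.left z' :=
      apply_eq_of_coeq_mk_eq σ.condition (by rw [ht₁', hy']) ht₂'
    rw [← h₁, ← h₂]
    apply q.left.hom.monotone
    rw [le_iff_of_isPullback hY, ht₁, ht₁', ht₂, ht₂']
    exact ⟨hyy', h.2⟩

/-- A monotone map along which all chains `b₀ ≤ b₁ ≤ b₂` lift is an effective descent morphism. -/
theorem LiftsChains.isEffectiveDescent (hp : LiftsChains p) : IsEffectiveDescent p := by
  have := LiftsChains.reflectsIsomorphisms_overPullback hp
  have : Monad.HasCoequalizerOfIsSplitPair (Over.pullback p) :=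
    ⟨fun f g _ => ⟨⟨⟨_, isColimitOverCoeq f g⟩⟩⟩⟩
  have : Monad.PreservesColimitOfIsSplitPair (Over.pullback p) := by
    refine ⟨fun {X Y} f g hs => ?_⟩
    obtain ⟨W, q, ⟨σ⟩⟩ := hs.splittable
    refine preservesColimit_of_preserves_colimit_cocone (isColimitOverCoeq f g) ?_
    refine (isColimitMapCoconeCoforkEquiv _ _).symm ?_
    have w : (Over.pullback p).map f ≫ (Over.pullback p).map (overCoeqπ f g) =
        (Over.pullback p).map g ≫ (Over.pullback p).map (overCoeqπ f g) := by
      rw [← Functor.map_comp, overCoeqπ_condition, Functor.map_comp]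
    have hk : q ≫ σ.isCoequalizer.desc (Cofork.ofπ _ w) =
        (Over.pullback p).map (overCoeqπ f g) :=
      σ.isCoequalizer.fac (Cofork.ofπ _ w) WalkingParallelPair.one
    have := isIso_of_isSplitCoequalizer hp σ hk
    exact IsColimit.ofIsoColimit σ.isCoequalizer 
      (Cofork.ext (@asIso _ _ _ _ (σ.isCoequalizer.desc (Cofork.ofπ _ w)) this) hk)
  exact (Monad.monadicOfHasPreservesGSplitCoequalizersOfReflectsIsomorphisms
    (Over.mapPullbackAdj p)).eqv

end Descent

/-! ### Posetal covers and the description of coverings -/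

/-- The pairs `(b, n)` with `b ∈ B` and `n ∈ ℕ`, as a partially ordered set over `B`. -/
structure Staircase (B : Type u) : Type u where
  /-- the underlying point -/
  pt : B
  /-- the level -/
  level : ℕ

/-- Strict growth of the level in every nontrivial comparison forces antisymmetry, yet leaves room
to lift finite chains of `B`. -/
instance (B : Type u) [Preorder B] : PartialOrder (Staircase B) where
  le x y := x = y ∨ x.pt ≤ y.pt ∧ x.level < y.level
  le_refl _ := .inl rfl
  le_trans := by
    rintro x y z (rfl | h) (rfl | h')
    · exact .inl rfl
    · exact .inr h'
    · exact .inr h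
    · exact .inr ⟨h.1.trans h'.1, h.2.trans h'.2⟩
  le_antisymm := by
    rintro x y (rfl | h) (h' | h')
    · rfl
    · rfl
    · exact h'.symm
    · exact absurd h.2 h'.2.asymm

/-- The projection of the staircase. -/
def staircaseπ (B : Preord.{u}) : Preord.of (Staircase B) ⟶ B :=
  Preord.ofHom ⟨Staircase.pt, by
    rintro x y (rfl | h)
    · exact le_rfl
    · exact h.1⟩

theorem isEffectiveDescent_staircaseπ (B : Preord.{u}) : IsEffectiveDescent (staircaseπ B) :=
  LiftsChains.isEffectiveDescent (p := staircaseπ B) fun b₀ b₁ b₂ h₀₁ h₁₂ =>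
    ⟨⟨b₀, 0⟩, ⟨b₁, 1⟩, ⟨b₂, 2⟩, .inr ⟨h₀₁, Nat.zero_lt_one⟩, .inr ⟨h₁₂, Nat.one_lt_two⟩,
      rfl, rfl, rfl⟩

theorem trivialCoverings_of_antisymm {X Y : Preord.{u}} (f : X ⟶ Y)
    (hX : ∀ x y : X, x ≤ y → y ≤ x → x = y) (hY : ∀ x y : Y, x ≤ y → y ≤ x → x = y) :
    trivialCoverings (forget₂ PartOrd.{u} Preord.{u}) f := by
  let P : PartOrd := @PartOrd.of X { toPreorder := X.str, le_antisymm := hX }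
  let Q : PartOrd := @PartOrd.of Y { toPreorder := Y.str, le_antisymm := hY }
  let g : P ⟶ Q := ConcreteCategory.ofHom (C := PartOrd) (X := P) (Y := Q) ⟨f, f.hom.monotone⟩
  exact ⟨P, Q, g, 𝟙 X, 𝟙 Y, IsPullback.id_horiz f⟩

theorem eq_of_trivialCoverings {X Y : Preord.{u}} {f : X ⟶ Y}
    (hf : trivialCoverings (forget₂ PartOrd.{u} Preord.{u}) f) {x x' : X} (h : f x = f x')
    (h₁ : x ≤ x') (h₂ : x' ≤ x) : x = x' := by
  obtain ⟨P, Q, g, a, b, hp⟩ := hf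
  exact eq_of_isPullback hp
    (le_antisymm (α := P) (a.hom.monotone h₁) (a.hom.monotone h₂)) h

/-- The coverings are the monotone maps with partially ordered fibres. -/
theorem coverings_iff {A B : Preord.{u}} (f : A ⟶ B) :
    coverings (forget₂ PartOrd.{u} Preord.{u}) f ↔
      ∀ x y : A, f x = f y → x ≤ y → y ≤ x → x = y := by
  constructor
  · rintro ⟨E, p, hp, hf⟩ x y h h₁ h₂
    have hP := IsPullback.of_hasPullback p f
    obtain ⟨e, he⟩ := hp.surjective (f x)
    obtain ⟨z, hz, rfl⟩ := exists_of_isPullback hP he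
    obtain ⟨z', hz', rfl⟩ := exists_of_isPullback hP (he.trans h)
    have hzz' := hz.trans hz'.symm
    rw [eq_of_trivialCoverings hf hzz' ((le_iff_of_isPullback hP).2 ⟨hzz'.le, h₁⟩)
      ((le_iff_of_isPullback hP).2 ⟨hzz'.ge, h₂⟩)]
  · intro hf
    have hP := IsPullback.of_hasPullback (staircaseπ B) f
    refine ⟨_, staircaseπ B, isEffectiveDescent_staircaseπ B, trivialCoverings_of_antisymm _
      (fun z z' h h' => ?_) (fun x y h h' => le_antisymm (α := Staircase B) h h')⟩
    rw [le_iff_of_isPullback hP] at h h'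
    -- Equivalent points of the pullback agree in the staircase, hence their components in `A` lie
    -- in one fibre of `f`.
    have hz := le_antisymm (α := Staircase B) h.1 h'.1
    refine eq_of_isPullback hP hz (hf _ _ ?_ h.2 h'.2)
    rw [← apply_eq_of_isPullback hP, ← apply_eq_of_isPullback hP]
    exact congrArg (staircaseπ B) hz

/-! ### The monotone-light factorization -/

theorem orthogonal_of_surjectiveFullyFaithful {A B X Y : Preord.{u}} {e : A ⟶ B} {m : X ⟶ Y}
    (he : surjectiveFullyFaithful e) (hm : ∀ x y : X, m x = m y → x ≤ y → y ≤ x → x = y) :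
    Orthogonal e m := by
  intro a b w
  have hw : ∀ x, m (a x) = b (e x) := ConcreteCategory.congr_hom w
  obtain ⟨hs, hf⟩ := he
  -- Points with the same image under `e` are equivalent by full faithfulness; `a` sends them to
  -- equivalent points in one fibre of `m`, hence to the same point. The choice of section is thus
  -- immaterial.
  have ha : ∀ x, a (Function.surjInv hs (e x)) = a x := by
    intro x
    have h := Function.surjInv_eq hs (e x)
    refine hm _ _ (by rw [hw, hw, h]) (a.hom.monotone ?_) (a.hom.monotone ?_)
    · exact (hf _ _).1 h.le
    · exact (hf _ _).1 h.ge
  let d : B ⟶ X := Preord.ofHom ⟨fun y => a (Function.surjInv hs y), fun y y' h =>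
    a.hom.monotone
    ((hf _ _).1 (by rwa [Function.surjInv_eq hs, Function.surjInv_eq hs]))⟩
  refine ⟨d, ⟨Preord.ext ha, Preord.ext fun y => ?_⟩, fun k hk => Preord.ext fun y => ?_⟩
  · exact (hw _).trans (congrArg b (Function.surjInv_eq hs y))
  · obtain ⟨x, rfl⟩ := hs y
    exact (ConcreteCategory.congr_hom hk.1 x).trans (ha x).symm

/-- Two equivalent points of a preordered set with the same image. -/
def fibreSetoid {X Y : Preord.{u}} (f : X ⟶ Y) : Setoid X where
  r x y := f x = f y ∧ AntisymmRel (· ≤ ·) x y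
  iseqv :=
    ⟨fun _ => ⟨rfl, .rfl⟩, fun h => ⟨h.1.symm, h.2.symm⟩,
      fun h h' => ⟨h.1.trans h'.1, h.2.trans h'.2⟩⟩

/-- The preordered set obtained by identifying equivalent points with the same image. -/
def FibreQuotient {X Y : Preord.{u}} (f : X ⟶ Y) : Type u := Quotient (fibreSetoid f)

instance {X Y : Preord.{u}} (f : X ⟶ Y) : Preorder (FibreQuotient f) where
  le := Quotient.lift₂ (· ≤ ·) fun _ _ _ _ h h' => propext
    ⟨fun k => h.2.2.trans (k.trans h'.2.1), fun k => h.2.1.trans (k.trans h'.2.2)⟩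
  le_refl := Quotient.ind fun _ => le_refl (α := X) _
  le_trans a b c := Quotient.inductionOn₃ a b c fun _ _ _ => le_trans (α := X)

theorem exists_surjectiveFullyFaithful_fac {X Y : Preord.{u}} (f : X ⟶ Y) :
    ∃ (Z : Preord.{u}) (e : X ⟶ Z) (m : Z ⟶ Y), surjectiveFullyFaithful e ∧
      (∀ x y : Z, m x = m y → x ≤ y → y ≤ x → x = y) ∧ e ≫ m = f := by
  let Z : Preord.{u} := .of (FibreQuotient f)
  let e : X ⟶ Z := Preord.ofHom ⟨Quotient.mk _, fun _ _ h => h⟩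
  let m : Z ⟶ Y := Preord.ofHom ⟨Quotient.lift f fun _ _ h => h.1,
    fun a b => Quotient.inductionOn₂ a b fun _ _ h => f.hom.monotone h⟩
  exact ⟨Z, e, m, ⟨Quotient.mk_surjective, fun _ _ => Iff.rfl⟩,
    fun a b => Quotient.inductionOn₂ a b fun _ _ h h₁ h₂ => Quotient.sound ⟨h, h₁, h₂⟩, rfl⟩

theorem surjectiveFullyFaithful_respectsIso :
    surjectiveFullyFaithful.{u}.RespectsIso := by
  refine .mk _ (fun e f hf => ⟨?_, fun x y => ?_⟩) (fun e f hf => ⟨?_, fun x y => ?_⟩)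
  · exact hf.1.comp (bijective_of_isIso e.hom).2
  · exact (hf.2 _ _).trans (le_iff_of_isIso e.hom x y)
  · exact (bijective_of_isIso e.hom).2.comp hf.1
  · exact (le_iff_of_isIso e.hom _ _).trans (hf.2 x y)

theorem coverings_respectsIso :
    (coverings (forget₂ PartOrd.{u} Preord.{u})).RespectsIso := by
  refine .mk _ (fun e f hf => ?_) (fun e f hf => ?_) <;> rw [coverings_iff] at hf ⊢ <;>
    intro x y h h₁ h₂
  · exact (bijective_of_isIso e.hom).1
      (hf _ _ h (e.hom.hom.monotone h₁) (e.hom.hom.monotone h₂))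
  · exact hf _ _ ((bijective_of_isIso e.hom).1 h) h₁ h₂

theorem isFactorizationSystem_surjectiveFullyFaithful_coverings :
    IsFactorizationSystem surjectiveFullyFaithful.{u}
      (coverings (forget₂ PartOrd.{u} Preord.{u})) where
  respectsIso_left := surjectiveFullyFaithful_respectsIso
  respectsIso_right := coverings_respectsIso
  orthogonal := fun _ _ _ _ _ m he hm =>
    orthogonal_of_surjectiveFullyFaithful he ((coverings_iff m).1 hm)
  factorization := fun _ _ f => by
    obtain ⟨Z, e, m, he, hm, h⟩ := exists_surjectiveFullyFaithful_fac f
    exact ⟨Z, e, m, he, (coverings_iff m).2 hm, h⟩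

/-- The inclusion of partially ordered sets in preordered sets is fully faithful. -/
def fullyFaithfulForget₂ : (forget₂ PartOrd.{u} Preord.{u}).FullyFaithful where
  preimage f := PartOrd.ofHom f.hom

end MonotoneLight

theorem mainTheorem3 :
    MonotoneLight.InducesMonotoneLight preordToPartOrdForgetAdjunction.{u}
      MonotoneLight.surjectiveFullyFaithful.{u}
      (MonotoneLight.coverings (forget₂ PartOrd.{u} Preord.{u})) :=
  { fullyFaithful := ⟨MonotoneLight.fullyFaithfulForget₂⟩
    isFactorizationSystem_reflective :=
      MonotoneLight.isFactorizationSystem_inverted_trivialCoverings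
    eq_stablyInverted := MonotoneLight.surjectiveFullyFaithful_eq_stablyInverted
    eq_coverings := rfl
    isFactorizationSystem :=
      MonotoneLight.isFactorizationSystem_surjectiveFullyFaithful_coverings }
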